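/- **Setting.** Two nondegenerate optical parametric amplifiers with cavity modes $a_1,b_1$ and $a_2,b_2$ are connected in a coherent feedback loop with transmission losses, amplification losses and path phase shifts $\theta_1,\theta_2$; adjustable phase shifters $\phi_1,\phi_2$ act on the two outputs: $$\begin{aligned} \dot a_1&=-\tfrac{\gamma+\kappa}{2}a_1+\tfrac{\epsilon}{2}b_1^*-\sqrt\gamma\,\xi_{in,a,1}-\sqrt\kappa\,\xi_{loss,a,1},\\ \dot b_1&=-\tfrac{\gamma+\kappa}{2}b_1+\tfrac{\epsilon}{2}a_1^*-\alpha\gamma e^{i\theta_2}b_2-\alpha\sqrt\gamma e^{i\theta_2}\xi_{in,b,2}-\sqrt\kappa\,\xi_{loss,b,1}-\beta\sqrt\gamma\,\xi_{BS,2},\\ \dot a_2&=-\tfrac{\gamma+\kappa}{2}a_2+\tfrac{\epsilon}{2}b_2^*-\alpha\gamma e^{i\theta_1}a_1-\alpha\sqrt\gamma e^{i\theta_1}\xi_{in,a,1}-\sqrt\kappa\,\xi_{loss,a,2}-\beta\sqrt\gamma\,\xi_{BS,1},\\ \dot b_2&=-\tfrac{\gamma+\kappa}{2}b_2+\tfrac{\epsilon}{2}a_2^*-\sqrt\gamma\,\xi_{in,b,2}-\sqrt\kappa\,\xi_{loss,b,2},\\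 \xi_{out,b,1}&=\sqrt\gamma e^{i\phi_1}b_1+\alpha\sqrt\gamma e^{i(\theta_2+\phi_1)}b_2+\alpha e^{i(\theta_2+\phi_1)}\xi_{in,b,2}+\beta e^{i\phi_1}\xi_{BS,2},\\ \xi_{out,a,2}&=\sqrt\gamma e^{i\phi_2}a_2+\alpha\sqrt\gamma e^{i(\theta_1+\phi_2)}a_1+\alpha e^{i(\theta_1+\phi_2)}\xi_{in,a,1}+\beta e^{i\phi_2}\xi_{BS,1}. \end{aligned}$$ Here $\epsilon=x\gamma_r$, $\gamma=\gamma_r/y$, $\gamma_r=7.2\times10^7$, $\kappa=\frac{3\times10^6}{\sqrt2\times0.6}x$, $\beta=\sqrt{1-\alpha^2}$, with $0<x,y,\alpha\le1$ and $\theta_1,\theta_2,\phi_1,\phi_2\in(-\pi,\pi]$. In the quadratures $c^q=c+c^*$, $c^p=(c-c^*)/i$ of the modes and fields the system reads $\dot z=Az+B\xi$, $\xi_{out}=Cz+D\xi$ with real matrices $A,B,C,D$ and $\xi_{out}=(\xi_{out,b,1}^q,\xi_{out,b,1}^p,\xi_{out,a,2}^q,\xi_{out,a,2}^p)^T$. The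 system is assumed stable: all eigenvalues of $A$ have negative real part (this condition does not involve $\phi_1,\phi_2$). The zero-frequency two-mode squeezing spectra are $$V_+=\operatorname{Tr}[H_1^*H_1],\quad V_-=\operatorname{Tr}[H_2^*H_2],\quad H=D-CA^{-1}B,\quad H_1=[1\ 0\ 1\ 0]\,H,\quad H_2=[0\ 1\ 0\ {-1}]\,H .$$ Put $m=\frac{\theta_1-\theta_2}{2}$, $n=\frac{\theta_1+\theta_2}{2}$ and $\phi=\phi_1+\phi_2\in(-2\pi,2\pi]$. **Lemma.** For fixed $x,y,\alpha,\theta_1,\theta_2$ as above, $V_+$ and $V_-$ depend on $(\phi_1,\phi_2)$ only through $\phi$, and: 1. if $m\in(-\frac\pi2,\frac\pi2)$, then $\phi_0=-n$ is an admissible value of $\phi$ and minimizes both $V_+$ and $V_-$ over all admissible $\phi_1,\phi_2$; 2. if $m\in(-\pi,-\frac\pi2)\cup(\frac\pi2,\pi]$, then each of $\phi_0=\pi-n$ and $\phi_0=-\pi-n$ is an admissible value of $\phi$ and minimizes both $V_+$ and $V_-$ over all admissible $\phi_1,\phi_2$; 3. if $m=\pm\frac\pi2$, then neither $V_+$ nor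 $V_-$ depends on $\phi_1,\phi_2$. -/

import Mathlib

open Real Set

namespace DualNOPA

noncomputable section

/-- A linear quantum system in quadrature form, `ż = A z + B ξ`, `ξ_out = C z + D ξ`, with
`n` modes, `k` input fields and `l` output fields. The index `(j, 0)` is the amplitude quadrature
(`a + a*`) and `(j, 1)` the phase quadrature (`(a - a*) / i`) of the mode or field number `j`. -/
structure LinearSystem (n k l : ℕ) where
  A : Matrix (Fin n × Fin 2) (Fin n × Fin 2) ℝ
  B : Matrix (Fin n × Fin 2) (Fin k × Fin 2) ℝ
  C : Matrix (Fin l × Fin 2) (Fin n × Fin 2) ℝ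
  D : Matrix (Fin l × Fin 2) (Fin k × Fin 2) ℝ

/-- Stability: the matrix `A` is Hurwitz, all its complex eigenvalues have negative real part. -/
def LinearSystem.IsStable {n k l : ℕ} (S : LinearSystem n k l) : Prop :=
  ∀ z ∈ spectrum ℂ (S.A.map (algebraMap ℝ ℂ)), z.re < 0

/-- The transfer matrix at frequency `ω = 0`, i.e. `C (0 - A)⁻¹ B + D = D - C A⁻¹ B`. -/
def LinearSystem.H {n k l : ℕ} (S : LinearSystem n k l) :
    Matrix (Fin l × Fin 2) (Fin k × Fin 2) ℝ :=
  S.D - S.C * S.A⁻¹ * S.B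

/-- The row `[1 0 1 0]`, which reads off `ξ_out,1^q + ξ_out,2^q`. -/
def rowPlus : Matrix (Fin 1) (Fin 2 × Fin 2) ℝ :=
  Matrix.of fun _ p => !![1, 0; 1, 0] p.1 p.2

/-- The row `[0 1 0 -1]`, which reads off `ξ_out,1^p - ξ_out,2^p`. -/
def rowMinus : Matrix (Fin 1) (Fin 2 × Fin 2) ℝ :=
  Matrix.of fun _ p => !![0, 1; 0, -1] p.1 p.2

/-- The two-mode amplitude squeezing spectrum at `ω = 0`: `V₊(0) = Tr[H₁* H₁]`,
where `H₁ = [1 0 1 0] H` (a real matrix, so that `*` is the transpose). -/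
def LinearSystem.Vplus {k : ℕ} {n : ℕ} (S : LinearSystem n k 2) : ℝ :=
  ((rowPlus * S.H).transpose * (rowPlus * S.H)).trace

/-- The two-mode phase squeezing spectrum at `ω = 0`: `V₋(0) = Tr[H₂* H₂]`,
where `H₂ = [0 1 0 -1] H`. -/
def LinearSystem.Vminus {k : ℕ} {n : ℕ} (S : LinearSystem n k 2) : ℝ :=
  ((rowMinus * S.H).transpose * (rowMinus * S.H)).trace

/-- The phase factor `e^{iθ}`. -/
def phase (θ : ℝ) : ℂ := Complex.exp (θ * Complex.I)

/-- The quadrature form of the real-linear map `c ↦ U c + V c*`. For each entry, with `c^q = c + c*`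
and `c^p = (c - c*) / i`, the operator `d = u c + v c*` has
`d^q = (Re u + Re v) c^q + (Im v - Im u) c^p` and
`d^p = (Im u + Im v) c^q + (Re u - Re v) c^p`. -/
def quadratures {r s : ℕ} (U V : Matrix (Fin r) (Fin s) ℂ) :
    Matrix (Fin r × Fin 2) (Fin s × Fin 2) ℝ :=
  Matrix.of fun p q =>
    !![(U p.1 q.1).re + (V p.1 q.1).re, (V p.1 q.1).im - (U p.1 q.1).im;
       (U p.1 q.1).im + (V p.1 q.1).im, (U p.1 q.1).re - (V p.1 q.1).re] p.2 q.2

/-- The dual-NOPA coherent feedback system with pump coupling `ε`, damping rates `γ` and `κ`,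
transmission rate `α`, reflection rate `β`, path phase shifts `θ₁`, `θ₂` and output phase
shifts `φ₁`, `φ₂`:
* `ȧ₁ = -(γ+κ)/2 a₁ + ε/2 b₁* - √γ ξ_in,a,1 - √κ ξ_loss,a,1`
* `ḃ₁ = -(γ+κ)/2 b₁ + ε/2 a₁* - αγ e^{iθ₂} b₂ - α√γ e^{iθ₂} ξ_in,b,2 - √κ ξ_loss,b,1 - β√γ ξ_BS,2`
* `ȧ₂ = -(γ+κ)/2 a₂ + ε/2 b₂* - αγ e^{iθ₁} a₁ - α√γ e^{iθ₁} ξ_in,a,1 - √κ ξ_loss,a,2 - β√γ ξ_BS,1`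
* `ḃ₂ = -(γ+κ)/2 b₂ + ε/2 a₂* - √γ ξ_in,b,2 - √κ ξ_loss,b,2`
* `ξ_out,b,1 = √γ e^{iφ₁} b₁ + α√γ e^{i(θ₂+φ₁)} b₂ + α e^{i(θ₂+φ₁)} ξ_in,b,2 + β e^{iφ₁} ξ_BS,2`
* `ξ_out,a,2 = √γ e^{iφ₂} a₂ + α√γ e^{i(θ₁+φ₂)} a₁ + α e^{i(θ₁+φ₂)} ξ_in,a,1 + β e^{iφ₂} ξ_BS,1`

Modes: `a₁, b₁, a₂, b₂`. Inputs: `ξ_in,a,1`, `ξ_in,b,2`, `ξ_loss,a,1`, `ξ_loss,b,1`, `ξ_loss,a,2`,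
`ξ_loss,b,2`, `ξ_BS,1`, `ξ_BS,2`. Outputs: `ξ_out,b,1`, `ξ_out,a,2`. -/
def dualNOPA (ε γ κ α β θ₁ θ₂ φ₁ φ₂ : ℝ) : LinearSystem 4 8 2 where
  A := quadratures
    !![-((γ + κ) / 2 : ℂ), 0, 0, 0;
       0, -((γ + κ) / 2 : ℂ), 0, -(α * γ * phase θ₂);
       -(α * γ * phase θ₁), 0, -((γ + κ) / 2 : ℂ), 0;
       0, 0, 0, -((γ + κ) / 2 : ℂ)]
    !![0, (ε / 2 : ℂ), 0, 0;
       (ε / 2 : ℂ), 0, 0, 0;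
       0, 0, 0, (ε / 2 : ℂ);
       0, 0, (ε / 2 : ℂ), 0]
  B := quadratures
    !![-(√γ : ℂ), 0, -(√κ : ℂ), 0, 0, 0, 0, 0;
       0, -(α * √γ * phase θ₂), 0, -(√κ : ℂ), 0, 0, 0, -(β * √γ : ℂ);
       -(α * √γ * phase θ₁), 0, 0, 0, -(√κ : ℂ), 0, -(β * √γ : ℂ), 0;
       0, -(√γ : ℂ), 0, 0, 0, -(√κ : ℂ), 0, 0]
    0
  C := quadratures
    !![0, √γ * phase φ₁, 0, α * √γ * phase (θ₂ + φ₁);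
       α * √γ * phase (θ₁ + φ₂), 0, √γ * phase φ₂, 0]
    0
  D := quadratures
    !![0, α * phase (θ₂ + φ₁), 0, 0, 0, 0, 0, β * phase φ₁;
       α * phase (θ₁ + φ₂), 0, 0, 0, 0, 0, β * phase φ₂, 0]
    0

/-- The reference value `γ_r = 7.2 × 10⁷` (in Hz) of the transmissivity mirrors. -/
def γr : ℝ := 7.2 * 10 ^ 7

/-- The lossy system with the physical parameters expressed by `x, y ∈ (0, 1]` and `α ∈ (0, 1]`:
`ε = x γ_r`, `γ = γ_r / y`, `κ = 3 × 10⁶ / (√2 × 0.6) x`, `β = √(1 - α²)`. -/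
def lossySystem (x y α θ₁ θ₂ φ₁ φ₂ : ℝ) : LinearSystem 4 8 2 :=
  dualNOPA (x * γr) (γr / y) (3 * 10 ^ 6 / (√2 * 0.6) * x) α √(1 - α ^ 2) θ₁ θ₂ φ₁ φ₂

/-- For fixed `x, y, α, θ₁, θ₂`, the value `φ₀` of `φ = φ₁ + φ₂` is admissible (it lies in
`(-2π, 2π]`), and every choice of output phase shifts in `(-π, π]` with sum `φ₀` minimizes both
`V₊(0)` and `V₋(0)` among all output phase shifts in `(-π, π]`. -/
def MinimizesSpectra (x y α θ₁ θ₂ φ₀ : ℝ) : Prop :=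
  φ₀ ∈ Ioc (-(2 * π)) (2 * π) ∧
  ∀ φ₁ ∈ Ioc (-π) π, ∀ φ₂ ∈ Ioc (-π) π, φ₁ + φ₂ = φ₀ →
    ∀ ψ₁ ∈ Ioc (-π) π, ∀ ψ₂ ∈ Ioc (-π) π,
      (lossySystem x y α θ₁ θ₂ φ₁ φ₂).Vplus ≤ (lossySystem x y α θ₁ θ₂ ψ₁ ψ₂).Vplus ∧
      (lossySystem x y α θ₁ θ₂ φ₁ φ₂).Vminus ≤ (lossySystem x y α θ₁ θ₂ ψ₁ ψ₂).Vminus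

end

end DualNOPA

namespace DualNOPA

/-! The variables `a₁, b₁*, a₂, b₂*` evolve among themselves by a complex linear system. Both
spectra read off `2 Re (u (b₁* + a₂))` at the outputs, with `u = 1` for `V₊` and `u = i` for `V₋`,
so they coincide. Each transfer coefficient has the form `v (e^{iφ₂} Q j + e^{-iφ₁} P j)` with `Q`,
`P` free of the output phases. Hence `V = const + 2|v|² Re (e^{iφ} ∑ Q j conj (P j))`.

`sum_transferA_mul_transferB` evaluates the sum as `-k (e^{iθ₁} + e^{iθ₂})` with `k` real, so `V = c
- K cos m cos (φ + n)`. Stability together with `4κ ≤ γ` gives `k ≥ 0` (`stable_lt_and_le`,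
`dualNOPA_spectra`). Minimizing `V` then means making `cos m cos (φ + n)` equal to `|cos m|`. -/

theorem phase_re (θ : ℝ) : (phase θ).re = cos θ := by
  simp [phase, Complex.exp_ofReal_mul_I_re]

theorem phase_im (θ : ℝ) : (phase θ).im = sin θ := by
  simp [phase, Complex.exp_ofReal_mul_I_im]

theorem phase_add (a b : ℝ) : phase (a + b) = phase a * phase b := by
  simp [phase, ← Complex.exp_add, add_mul]

theorem conj_phase (θ : ℝ) : (starRingEnd ℂ) (phase θ) = phase (-θ) := by
  simp [phase, ← Complex.exp_conj]

theorem phase_eq (θ : ℝ) : phase θ = (cos θ : ℂ) + (sin θ : ℂ) * Complex.I := by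
  simp [phase, Complex.exp_mul_I]

theorem phase_neg_eq (θ : ℝ) : phase (-θ) = (cos θ : ℂ) - (sin θ : ℂ) * Complex.I := by
  simp [phase_eq, sub_eq_add_neg]

theorem phase_mul_phase_neg (θ : ℝ) : phase θ * phase (-θ) = 1 := by
  rw [← phase_add]; simp [phase]

theorem phase_ne_zero (θ : ℝ) : phase θ ≠ 0 := Complex.exp_ne_zero _

/-! ### Consequences of stability -/

/-- The eigenvalues of the dynamics: `z - (γ + κ) / 2`, where `z² - ε² / 4 = (ε α γ / 2) ζ` for a
square root `ζ` of `e^{i(θ₁ - θ₂)}`. -/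
theorem mem_spectrum_dualNOPA (ε γ κ α β θ₁ θ₂ φ₁ φ₂ : ℝ) (hε : ε ≠ 0) {z ζ : ℂ}
    (hζ : ζ ^ 2 = phase θ₁ * phase (-θ₂))
    (hz : z ^ 2 = (ε / 2 : ℂ) ^ 2 + (ε / 2 : ℂ) * (α * γ) * ζ) :
    z - ((γ + κ) / 2 : ℂ) ∈
      spectrum ℂ ((dualNOPA ε γ κ α β θ₁ θ₂ φ₁ φ₂).A.map (algebraMap ℝ ℂ)) := by
  have hζ0 : ζ ≠ 0 := by
    rintro rfl
    exact mul_ne_zero (phase_ne_zero θ₁) (phase_ne_zero (-θ₂)) (by simpa using hζ.symm)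
  rw [spectrum.mem_iff, Matrix.isUnit_iff_isUnit_det, isUnit_iff_ne_zero, not_not,
    ← Matrix.exists_mulVec_eq_zero_iff]
  set e : ℂ := (ε / 2 : ℂ) with he
  set q := phase (-θ₂) with hq
  -- The eigenvector of the `a₁, b₁*, a₂, b₂*` system is `(-q e, -q z, ζ z, ζ e)`. A phase
  -- quadrature equal to `-i` times the amplitude one keeps only the mode, `+i` only its adjoint.
  refine ⟨fun p => ![![-q * e, -Complex.I * (-q * e)], ![-q * z, Complex.I * (-q * z)],
    ![ζ * z, -Complex.I * (ζ * z)], ![ζ * e, Complex.I * (ζ * e)]] p.1 p.2, ?_, ?_⟩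
  · intro h
    have := congrFun h (3, 0)
    simp [hζ0, he, hε] at this
  · rw [phase_eq] at hζ
    have hI := Complex.I_sq
    have hqe : q = (cos θ₂ : ℂ) - (sin θ₂ : ℂ) * Complex.I := phase_neg_eq θ₂
    clear_value q e
    push_cast at hζ hqe
    ext ⟨i, j⟩
    fin_cases i <;> fin_cases j <;>
      simp [Matrix.mulVec, dotProduct, Fintype.sum_prod_type, Fin.sum_univ_four, dualNOPA,
        quadratures, Matrix.algebraMap_matrix_apply, phase_re, phase_im]
    all_goals rw [← he]
    · ring
    · ring
    · linear_combination -q * hz - α * γ * ζ * e * hqe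
    · linear_combination Complex.I * (-q * hz - α * γ * ζ * e * hqe) +
        α * γ * Complex.sin θ₂ * ζ * e * hI
    · linear_combination ζ * hz + e * α * γ * hζ
    · linear_combination -Complex.I * (ζ * hz + e * α * γ * hζ) -
        α * γ * q * e * Complex.sin θ₁ * hI
    · ring
    · ring

theorem exists_sq_eq_re_nonneg (w : ℂ) : ∃ z : ℂ, z ^ 2 = w ∧ 0 ≤ z.re := by
  obtain ⟨z, hz⟩ := IsAlgClosed.exists_pow_nat_eq w (n := 2) (by norm_num)
  rcases le_total 0 z.re with h | h
  · exact ⟨z, hz, h⟩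
  · exact ⟨-z, by simpa using hz, by simpa using h⟩

theorem LinearSystem.IsStable.isUnit_det {n k l : ℕ} {S : LinearSystem n k l}
    (h : S.IsStable) : IsUnit S.A.det := by
  rw [isUnit_iff_ne_zero]
  intro h0
  refine lt_irrefl (0 : ℝ) (h 0 ?_)
  rw [spectrum.zero_mem_iff, Matrix.isUnit_iff_isUnit_det, isUnit_iff_ne_zero, not_not]
  have := (RingHom.map_det (algebraMap ℝ ℂ) S.A).symm
  rw [h0, map_zero] at this
  exact this

/-- Choosing both square roots with nonnegative real part, stability says `Re z < g = (γ + κ) / 2`.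
Real and imaginary parts of the equation for `z²` turn this into bounds free of `θ₁, θ₂`. -/
theorem stable_lt_and_le {ε γ κ α β θ₁ θ₂ φ₁ φ₂ : ℝ} (hε : 0 < ε) (hγ : 0 < γ) (hκ : 0 ≤ κ)
    (hα : α ∈ Ioc (0 : ℝ) 1) (hs : (dualNOPA ε γ κ α β θ₁ θ₂ φ₁ φ₂).IsStable) :
    ε / 2 < (γ + κ) / 2 ∧
      (ε / 2) ^ 2 * (α * γ) ^ 2 ≤ 4 * ((γ + κ) / 2) ^ 2 * (((γ + κ) / 2) ^ 2 - (ε / 2) ^ 2) := by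
  obtain ⟨ζ, hζ, hζre⟩ := exists_sq_eq_re_nonneg (phase θ₁ * phase (-θ₂))
  obtain ⟨z, hz, hzre⟩ :=
    exists_sq_eq_re_nonneg ((ε / 2 : ℂ) ^ 2 + (ε / 2 : ℂ) * (α * γ) * ζ)
  have hlt := hs _ (mem_spectrum_dualNOPA ε γ κ α β θ₁ θ₂ φ₁ φ₂ hε.ne' hζ hz)
  have hnorm : ζ.re ^ 2 + ζ.im ^ 2 = 1 := by
    have h1 : ‖ζ‖ ^ 2 = 1 := by
      rw [← norm_pow, hζ, ← phase_add, phase, Complex.norm_exp_ofReal_mul_I]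
    rw [Complex.sq_norm, Complex.normSq_apply] at h1
    linarith
  have hre := congrArg Complex.re hz
  have him := congrArg Complex.im hz
  have hc : ((ε / 2 : ℂ) ^ 2 + (ε / 2 : ℂ) * (α * γ) * ζ) =
      (((ε / 2) ^ 2 : ℝ) : ℂ) + (((ε / 2) * (α * γ) : ℝ) : ℂ) * ζ := by push_cast; ring
  have hg : z - ((γ + κ) / 2 : ℂ) = z - (((γ + κ) / 2 : ℝ) : ℂ) := by push_cast; ring
  rw [hc] at hre him
  rw [hg, Complex.sub_re, Complex.ofReal_re] at hlt
  simp only [sq z, Complex.mul_re, Complex.mul_im, Complex.add_re, Complex.add_im,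
    Complex.ofReal_re, Complex.ofReal_im] at hre him
  have he : 0 < ε / 2 := by positivity
  have hG : 0 < α * γ := mul_pos hα.1 hγ
  have hGg : α * γ ≤ 2 * ((γ + κ) / 2) := by nlinarith [hα.2]
  generalize ε / 2 = e at *
  generalize (γ + κ) / 2 = g at *
  generalize α * γ = G at *
  obtain ⟨a, b⟩ := z
  obtain ⟨c, s⟩ := ζ
  simp only at *
  have hg0 : 0 < g := by linarith
  have hac : e ^ 2 + e * G * c + b ^ 2 = a ^ 2 := by linarith
  have hag : a ^ 2 < g ^ 2 := by nlinarith
  have hGc : 0 ≤ e * G * c := by positivity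
  have heg : e < g := by nlinarith [sq_nonneg b]
  refine ⟨heg, ?_⟩
  have hsin : e ^ 2 * G ^ 2 * s ^ 2 ≤ 4 * g ^ 2 * (g ^ 2 - e ^ 2 - e * G * c) := by
    have h1 : e ^ 2 * G ^ 2 * s ^ 2 = 4 * a ^ 2 * b ^ 2 := by
      have : e * G * s = 2 * (a * b) := by linarith
      linear_combination (e * G * s + 2 * (a * b)) * this
    have h2 : 4 * a ^ 2 * b ^ 2 ≤ 4 * g ^ 2 * b ^ 2 := by gcongr
    have h3 : 4 * g ^ 2 * b ^ 2 ≤ 4 * g ^ 2 * (g ^ 2 - e ^ 2 - e * G * c) := by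
      gcongr; linarith
    linarith
  have hc1 : c ≤ 1 := by nlinarith [sq_nonneg s]
  have h4 : e * G * c ≤ 4 * g ^ 2 := by
    have : e * G * c ≤ g * (2 * g) * 1 := by gcongr
    nlinarith
  -- Added to `hsin`, this cancels the term linear in `c`, and `c² + s² = 1` removes the angle.
  have h5 : (e * G * c) ^ 2 ≤ 4 * g ^ 2 * (e * G * c) := by nlinarith
  have h6 : e ^ 2 * G ^ 2 * s ^ 2 + (e * G * c) ^ 2 = e ^ 2 * G ^ 2 := by
    linear_combination e ^ 2 * G ^ 2 * hnorm
  linarith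

/-- The determinant of the dynamics at zero frequency, up to a positive factor. -/
theorem stable_det_ne_zero {ε γ κ α β θ₁ θ₂ φ₁ φ₂ : ℝ} (hε : 0 < ε) (hγ : 0 < γ)
    (hα : 0 < α) (hs : (dualNOPA ε γ κ α β θ₁ θ₂ φ₁ φ₂).IsStable) :
    ((((γ + κ) / 2) ^ 2 - (ε / 2) ^ 2) ^ 2 -
      (ε / 2) ^ 2 * (α * γ) ^ 2 * (phase θ₁ * phase (-θ₂)) : ℂ) ≠ 0 := by
  intro h0
  have h1 : (ε / 2 : ℂ) * (α * γ) ≠ 0 := by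
    norm_cast
    positivity
  -- A vanishing determinant makes this quotient an admissible `ζ` with `z = g`, so `0` would be an
  -- eigenvalue.
  have := hs _ (mem_spectrum_dualNOPA ε γ κ α β θ₁ θ₂ φ₁ φ₂ hε.ne' (z := (γ + κ) / 2)
    (ζ := (((γ + κ) / 2) ^ 2 - (ε / 2) ^ 2) / ((ε / 2 : ℂ) * (α * γ))) ?_ ?_)
  · simp at this
  · rw [div_pow, div_eq_iff (pow_ne_zero 2 h1)]
    linear_combination h0
  · rw [mul_div_cancel₀ _ h1]
    ring

/-! ### Real rows as complex functionals -/

/-- The row `c ↦ 2 Re (∑ j, l j * c j)` in quadratures, where the `j`-th variable stands for a mode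
if `σ j = 1` and for the adjoint of a mode if `σ j = -1`. -/
def realRow {s : ℕ} (σ : Fin s → ℝ) (l : Fin s → ℂ) : Matrix (Fin 1) (Fin s × Fin 2) ℝ :=
  Matrix.of fun _ p => ![(l p.1).re, -σ p.1 * (l p.1).im] p.2

theorem trace_realRow {s : ℕ} (σ : Fin s → ℝ) (hσ : ∀ j, σ j ^ 2 = 1) (l : Fin s → ℂ) :
    ((realRow σ l).transpose * realRow σ l).trace = ∑ j, Complex.normSq (l j) := by
  simp only [Matrix.trace, Matrix.diag, Matrix.mul_apply, Matrix.transpose_apply, realRow,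
    Matrix.of_apply, Fintype.sum_prod_type, Fin.sum_univ_two, Fin.sum_univ_one]
  refine Finset.sum_congr rfl fun j _ => ?_
  simp only [Complex.normSq_apply, Matrix.cons_val_zero, Matrix.cons_val_one]
  linear_combination (l j).im ^ 2 * hσ j

theorem rowPlus_eq : rowPlus = realRow ![-1, 1] ![1, 1] := by
  ext i ⟨j, k⟩
  fin_cases j <;> fin_cases k <;> simp [rowPlus, realRow]

theorem rowMinus_eq : rowMinus = realRow ![-1, 1] ![Complex.I, Complex.I] := by
  ext i ⟨j, k⟩
  fin_cases j <;> fin_cases k <;> simp [rowMinus, realRow]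

/-- Solving four complex equations for the row replaces inverting the 8 × 8 real matrix `A`. -/
theorem realRow_mul_A {ε γ κ α β θ₁ θ₂ φ₁ φ₂ : ℝ} {u a b c d : ℂ}
    (ha : -((γ + κ) / 2) * a + ε / 2 * b - α * γ * phase θ₁ * c =
      u * (α * √γ * (phase θ₁ * phase φ₂)))
    (hb : ε / 2 * a - (γ + κ) / 2 * b = u * (√γ * phase (-φ₁)))
    (hc : -((γ + κ) / 2) * c + ε / 2 * d = u * (√γ * phase φ₂))
    (hd : ε / 2 * c - (γ + κ) / 2 * d - α * γ * phase (-θ₂) * b =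
      u * (α * √γ * (phase (-θ₂) * phase (-φ₁)))) :
    realRow ![1, -1, 1, -1] ![a, b, c, d] * (dualNOPA ε γ κ α β θ₁ θ₂ φ₁ φ₂).A =
      realRow ![-1, 1] ![u, u] * (dualNOPA ε γ κ α β θ₁ θ₂ φ₁ φ₂).C := by
  have hh : ((ε : ℂ) / 2) = ((ε / 2 : ℝ) : ℂ) := by push_cast; ring
  have hg : (((γ : ℂ) + κ) / 2) = (((γ + κ) / 2 : ℝ) : ℂ) := by push_cast; ring
  rw [hh, hg] at ha hb hc hd
  have ha1 := congrArg Complex.re ha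
  have ha2 := congrArg Complex.im ha
  have hb1 := congrArg Complex.re hb
  have hb2 := congrArg Complex.im hb
  have hc1 := congrArg Complex.re hc
  have hc2 := congrArg Complex.im hc
  have hd1 := congrArg Complex.re hd
  have hd2 := congrArg Complex.im hd
  clear ha hb hc hd
  simp only [Complex.mul_re, Complex.mul_im, Complex.add_re, Complex.add_im, Complex.sub_re,
    Complex.sub_im, Complex.neg_re, Complex.neg_im, Complex.ofReal_re, Complex.ofReal_im,
    phase_re, phase_im, cos_neg, sin_neg] at ha1 ha2 hb1 hb2 hc1 hc2 hd1 hd2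
  ext i ⟨j, k⟩
  fin_cases j <;> fin_cases k <;>
    simp [Matrix.mul_apply, Fintype.sum_prod_type, Fin.sum_univ_four, dualNOPA,
      quadratures, realRow, phase_add, phase_re, phase_im]
  · linear_combination ha1
  · linear_combination -ha2
  · linear_combination hb1
  · linear_combination hb2
  · linear_combination hc1
  · linear_combination -hc2
  · linear_combination hd1
  · linear_combination hd2

theorem realRow_D_sub (ε γ κ α β θ₁ θ₂ φ₁ φ₂ : ℝ) (u a b c d : ℂ) :
    realRow ![-1, 1] ![u, u] * (dualNOPA ε γ κ α β θ₁ θ₂ φ₁ φ₂).D -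
      realRow ![1, -1, 1, -1] ![a, b, c, d] * (dualNOPA ε γ κ α β θ₁ θ₂ φ₁ φ₂).B =
    realRow ![1, -1, 1, -1, 1, -1, 1, -1]
      ![u * (α * (phase θ₁ * phase φ₂)) + √γ * (a + α * phase θ₁ * c),
        u * (α * (phase (-θ₂) * phase (-φ₁))) + √γ * (d + α * phase (-θ₂) * b),
        √κ * a, √κ * b, √κ * c, √κ * d,
        β * (u * phase φ₂ + √γ * c), β * (u * phase (-φ₁) + √γ * b)] := by
  ext i ⟨j, k⟩
  fin_cases j <;> fin_cases k <;>
    simp [Matrix.mul_apply, Fintype.sum_prod_type, Fin.sum_univ_four, dualNOPA,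
      quadratures, realRow, phase_add, phase_re, phase_im]
  all_goals ring

theorem realRow_mul_H {ε γ κ α β θ₁ θ₂ φ₁ φ₂ : ℝ} {u a b c d : ℂ}
    (hA : IsUnit (dualNOPA ε γ κ α β θ₁ θ₂ φ₁ φ₂).A.det)
    (ha : -((γ + κ) / 2) * a + ε / 2 * b - α * γ * phase θ₁ * c =
      u * (α * √γ * (phase θ₁ * phase φ₂)))
    (hb : ε / 2 * a - (γ + κ) / 2 * b = u * (√γ * phase (-φ₁)))
    (hc : -((γ + κ) / 2) * c + ε / 2 * d = u * (√γ * phase φ₂))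
    (hd : ε / 2 * c - (γ + κ) / 2 * d - α * γ * phase (-θ₂) * b =
      u * (α * √γ * (phase (-θ₂) * phase (-φ₁)))) :
    realRow ![-1, 1] ![u, u] * (dualNOPA ε γ κ α β θ₁ θ₂ φ₁ φ₂).H =
    realRow ![1, -1, 1, -1, 1, -1, 1, -1]
      ![u * (α * (phase θ₁ * phase φ₂)) + √γ * (a + α * phase θ₁ * c),
        u * (α * (phase (-θ₂) * phase (-φ₁))) + √γ * (d + α * phase (-θ₂) * b),
        √κ * a, √κ * b, √κ * c, √κ * d,
        β * (u * phase φ₂ + √γ * c), β * (u * phase (-φ₁) + √γ * b)] := by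
  rw [← realRow_D_sub ε γ κ α β θ₁ θ₂ φ₁ φ₂ u a b c d, LinearSystem.H, Matrix.mul_sub,
    Matrix.mul_assoc, ← Matrix.mul_assoc (realRow _ _), ← realRow_mul_A ha hb hc hd,
    ← Matrix.mul_assoc, Matrix.mul_nonsing_inv_cancel_right _ _ hA]

/-! ### Explicit transfer coefficients and their cross term -/

noncomputable section

/-- The determinant of the dynamics of `a₁, b₁*` and `a₂, b₂*` at zero frequency, with `g` the
total damping rate, `e` the pump rate and `p`, `q` the phase factors of the two paths. -/
def loopDet (g e γ α p q : ℂ) : ℂ :=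
  (g ^ 2 - e ^ 2) ^ 2 - e ^ 2 * (α * γ) ^ 2 * (p * q)

/-- The response of `a₂ + α p a₁` to the inputs of the four modes `a₁, b₁*, a₂, b₂*`, multiplied
by `loopDet`. The response of `b₁* + α q b₂*` is obtained by exchanging `p, q` and reversing. -/
def response (g e γ α p q : ℂ) : Fin 4 → ℂ :=
  ![p * g * α * (g * γ - (g ^ 2 - e ^ 2)),
    e * p * α * (g * γ - (g ^ 2 - e ^ 2)),
    -(g ^ 2 - e ^ 2) * g + α ^ 2 * γ * e ^ 2 * (p * q),
    -e * (g ^ 2 - e ^ 2 + α ^ 2 * γ * (p * q) * (γ - g))]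

/-- The transfer coefficients of the output of `a₂`, multiplied by `loopDet`. -/
def transferA (g e γ α β ρ p q : ℂ) : Fin 8 → ℂ :=
  let R := response g e γ α p q
  ![α * p * loopDet g e γ α p q + γ * (R 0 + α * p * R 2), γ * (R 3 + α * q * R 1),
    ρ * R 0, ρ * R 1, ρ * R 2, ρ * R 3,
    β * (loopDet g e γ α p q + γ * R 2), β * (γ * R 1)]

/-- The transfer coefficients of the adjoint of the output of `b₁`, multiplied by `loopDet`. -/
def transferB (g e γ α β ρ p q : ℂ) : Fin 8 → ℂ :=
  let T := response g e γ α q p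
  ![γ * (T 3 + α * p * T 1), α * q * loopDet g e γ α p q + γ * (T 0 + α * q * T 2),
    ρ * T 3, ρ * T 2, ρ * T 1, ρ * T 0,
    β * (γ * T 1), β * (loopDet g e γ α p q + γ * T 2)]

/-- The inverses `p'`, `q'` stand for the conjugates of the phase factors, which makes the cross
term a rational identity. -/
theorem sum_transferA_mul_transferB {g e γ κ α β ρ p q p' q' : ℂ} (hp : p * p' = 1)
    (hq : q * q' = 1) (hκ : 2 * g = γ + κ) (hρ : ρ ^ 2 = γ * κ) (hβ : β ^ 2 = 1 - α ^ 2) :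
    ∑ j, transferA g e γ α β ρ p q j * transferB g e γ α β ρ p' q' j =
      -(2 * e * α * γ * (g * γ - (g ^ 2 - e ^ 2)) * (g ^ 4 - e ^ 4 - α ^ 2 * γ * κ * e ^ 2)) *
        (p + q') := by
  have hp0 : p ≠ 0 := left_ne_zero_of_mul_eq_one hp
  have hq0 : q' ≠ 0 := right_ne_zero_of_mul_eq_one hq
  obtain rfl : p' = p⁻¹ := eq_inv_of_mul_eq_one_right hp
  obtain rfl : q = q'⁻¹ := eq_inv_of_mul_eq_one_left hq
  obtain rfl : κ = 2 * g - γ := by linear_combination -hκ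
  set Δ := loopDet g e γ α p q'⁻¹ with hΔ
  set Δ' := loopDet g e γ α p⁻¹ q' with hΔ'
  set R := response g e γ α p q'⁻¹ with hR
  set T := response g e γ α q' p⁻¹ with hT
  have key : (α * p * Δ + γ * (R 0 + α * p * R 2)) * (γ * (T 3 + α * p⁻¹ * T 1)) +
      γ * (R 3 + α * q'⁻¹ * R 1) * (α * q' * Δ' + γ * (T 0 + α * q' * T 2)) +
      γ * (2 * g - γ) * (R 0 * T 3 + R 1 * T 2 + R 2 * T 1 + R 3 * T 0) +
      (1 - α ^ 2) * ((Δ + γ * R 2) * (γ * T 1) + γ * R 1 * (Δ' + γ * T 2)) =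
      -(2 * e * α * γ * (g * γ - (g ^ 2 - e ^ 2)) *
        (g ^ 4 - e ^ 4 - α ^ 2 * γ * (2 * g - γ) * e ^ 2)) * (p + q') := by
    simp only [hΔ, hΔ', hR, hT, loopDet, response, Matrix.cons_val]
    field_simp
    ring
  rw [← key]
  simp only [Fin.sum_univ_eight, transferA, transferB, ← hΔ, ← hΔ', ← hR, ← hT, Matrix.cons_val]
  linear_combination (R 0 * T 3 + R 1 * T 2 + R 2 * T 1 + R 3 * T 0) * hρ +
    ((Δ + γ * R 2) * (γ * T 1) + γ * R 1 * (Δ' + γ * T 2)) * hβ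

theorem conj_transferB (g e γ α β ρ : ℝ) (p q : ℂ) (j : Fin 8) :
    (starRingEnd ℂ) (transferB g e γ α β ρ p q j) =
      transferB g e γ α β ρ ((starRingEnd ℂ) p) ((starRingEnd ℂ) q) j := by
  fin_cases j <;> simp [transferB, response, loopDet]

theorem realRow_mul_H_eq {ε γ κ α β θ₁ θ₂ φ₁ φ₂ : ℝ} (u : ℂ) (hγ : 0 ≤ γ)
    (hA : IsUnit (dualNOPA ε γ κ α β θ₁ θ₂ φ₁ φ₂).A.det)
    (hΔ : loopDet ((γ + κ) / 2) (ε / 2) γ α (phase θ₁) (phase (-θ₂)) ≠ 0) :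
    realRow ![-1, 1] ![u, u] * (dualNOPA ε γ κ α β θ₁ θ₂ φ₁ φ₂).H =
    realRow ![1, -1, 1, -1, 1, -1, 1, -1] fun j =>
      u / loopDet ((γ + κ) / 2) (ε / 2) γ α (phase θ₁) (phase (-θ₂)) *
      (phase φ₂ * transferA ((γ + κ) / 2) (ε / 2) γ α β (√γ * √κ) (phase θ₁) (phase (-θ₂)) j +
      phase (-φ₁) * transferB ((γ + κ) / 2) (ε / 2) γ α β (√γ * √κ) (phase θ₁) (phase (-θ₂)) j) := by
  have hr : (√γ : ℂ) * √γ = γ := by exact_mod_cast Real.mul_self_sqrt hγ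
  set g : ℂ := (γ + κ) / 2 with hg
  set e : ℂ := ε / 2 with he
  set p := phase θ₁
  set q := phase (-θ₂)
  set R := response g e γ α p q with hR
  set T := response g e γ α q p with hT
  set Δ := loopDet g e γ α p q with hΔd
  -- `R` solves the row equations for the output `a₂`, `T` those for `b₁*`. The index reversal in
  -- `T` is the symmetry `a₁ ↔ b₂*`, `b₁* ↔ a₂`, which swaps `p` and `q`.
  rw [realRow_mul_H hA (u := u) (a := u / Δ * √γ * (phase φ₂ * R 0 + phase (-φ₁) * T 3))
    (b := u / Δ * √γ * (phase φ₂ * R 1 + phase (-φ₁) * T 2))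
    (c := u / Δ * √γ * (phase φ₂ * R 2 + phase (-φ₁) * T 1))
    (d := u / Δ * √γ * (phase φ₂ * R 3 + phase (-φ₁) * T 0))]
  · congr 1
    have hu : u = u / Δ * Δ := by field_simp
    generalize u / Δ = v at *
    subst hu
    ext j
    fin_cases j <;> simp only [transferA, transferB, ← hR, ← hT, ← hΔd, Fin.reduceFinMk,
      Fin.zero_eta, Fin.mk_one, Matrix.cons_val]
    · linear_combination v * ((phase φ₂ * R 0 + phase (-φ₁) * T 3) +
        α * p * (phase φ₂ * R 2 + phase (-φ₁) * T 1)) * hr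
    · linear_combination v * ((phase φ₂ * R 3 + phase (-φ₁) * T 0) +
        α * q * (phase φ₂ * R 1 + phase (-φ₁) * T 2)) * hr
    · ring
    · ring
    · ring
    · ring
    · linear_combination v * β * (phase φ₂ * R 2 + phase (-φ₁) * T 1) * hr
    · linear_combination v * β * (phase φ₂ * R 1 + phase (-φ₁) * T 2) * hr
  all_goals
    rw [← hg, ← he]
    have hu : u = u / Δ * Δ := by field_simp
    generalize u / Δ = v at *
    subst hu
    simp only [hΔd, loopDet, hR, hT, response, Matrix.cons_val]
    ring

end

/-! ### Dependence of the spectra on the output phases -/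

theorem normSq_phase (θ : ℝ) : Complex.normSq (phase θ) = 1 := by
  rw [← Complex.sq_norm, phase, Complex.norm_exp_ofReal_mul_I, one_pow]

theorem normSq_phase_combination (v a b : ℂ) (φ₁ φ₂ : ℝ) :
    Complex.normSq (v * (phase φ₂ * a + phase (-φ₁) * b)) =
      Complex.normSq v * (Complex.normSq a + Complex.normSq b) +
        2 * Complex.normSq v * (phase (φ₁ + φ₂) * (a * (starRingEnd ℂ) b)).re := by
  have h : phase φ₂ * a * (starRingEnd ℂ) (phase (-φ₁) * b) =
      phase (φ₁ + φ₂) * (a * (starRingEnd ℂ) b) := by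
    rw [map_mul, conj_phase, neg_neg, phase_add]
    ring
  rw [map_mul, Complex.normSq_add, h, map_mul, map_mul, normSq_phase, normSq_phase]
  ring

theorem dualNOPA_spectra {ε γ κ α β θ₁ θ₂ : ℝ} (hε : 0 < ε) (hγ : 0 < γ) (hκ : 0 ≤ κ)
    (hκγ : 4 * κ ≤ γ) (hα : α ∈ Ioc (0 : ℝ) 1) (hβ : β ^ 2 = 1 - α ^ 2)
    (hs : (dualNOPA ε γ κ α β θ₁ θ₂ 0 0).IsStable) :
    ∃ c K : ℝ, 0 ≤ K ∧ ∀ φ₁ φ₂ : ℝ,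
      (dualNOPA ε γ κ α β θ₁ θ₂ φ₁ φ₂).Vplus =
        c - K * (cos (φ₁ + φ₂ + θ₁) + cos (φ₁ + φ₂ + θ₂)) ∧
      (dualNOPA ε γ κ α β θ₁ θ₂ φ₁ φ₂).Vminus =
        c - K * (cos (φ₁ + φ₂ + θ₁) + cos (φ₁ + φ₂ + θ₂)) := by
  obtain ⟨heg, hstab⟩ := stable_lt_and_le hε hγ hκ hα hs
  have hΔ : loopDet ((γ + κ) / 2) (ε / 2) γ α (phase θ₁) (phase (-θ₂)) ≠ 0 :=
    stable_det_ne_zero hε hγ hα.1 hs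
  set Q := transferA ((γ + κ) / 2) (ε / 2) γ α β (√γ * √κ) (phase θ₁) (phase (-θ₂)) with hQ
  set P := transferB ((γ + κ) / 2) (ε / 2) γ α β (√γ * √κ) (phase θ₁) (phase (-θ₂)) with hP
  set Δ := loopDet ((γ + κ) / 2) (ε / 2) γ α (phase θ₁) (phase (-θ₂)) with hΔd
  set g : ℝ := (γ + κ) / 2 with hg
  set e : ℝ := ε / 2 with he
  set k : ℝ := 2 * e * α * γ * (g * γ - (g ^ 2 - e ^ 2)) *
    (g ^ 4 - e ^ 4 - α ^ 2 * γ * κ * e ^ 2) with hk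
  have he0 : 0 < e := by positivity
  have hk0 : 0 ≤ k := by
    -- Since `κ ≤ γ`, `g ≤ γ`.
    have h1 : 0 ≤ g * γ - (g ^ 2 - e ^ 2) := by nlinarith
    -- By `4κ ≤ γ` and `hstab`, `α²γκe² ≤ α²γ²e²/4 ≤ g²(g² - e²) ≤ g⁴ - e⁴`.
    have h2 : 0 ≤ g ^ 4 - e ^ 4 - α ^ 2 * γ * κ * e ^ 2 := by
      have h3 : α ^ 2 * γ * (4 * κ) * e ^ 2 ≤ α ^ 2 * γ * γ * e ^ 2 := by gcongr
      have h4 : 0 ≤ e ^ 2 * (g ^ 2 - e ^ 2) :=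
        mul_nonneg (sq_nonneg e) (by nlinarith)
      nlinarith
    have := hα.1
    positivity
  have hsum : ∑ j, Q j * (starRingEnd ℂ) (P j) = ((-k : ℝ) : ℂ) * (phase θ₁ + phase θ₂) := by
    have hc : ∀ j, (starRingEnd ℂ) (P j) = transferB g e γ α β (√γ * √κ)
        (phase (-θ₁)) (phase θ₂) j := fun j => by
      have := conj_transferB g e γ α β (√γ * √κ) (phase θ₁) (phase (-θ₂)) j
      rw [conj_phase, conj_phase, neg_neg] at this
      rw [hP, ← Complex.ofReal_mul, ← this, hg, he]
      push_cast
      rfl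
    simp only [hc]
    have hQ' : Q = transferA g e γ α β (√γ * √κ) (phase θ₁) (phase (-θ₂)) := by
      rw [hQ, hg, he]
      push_cast
      rfl
    rw [hQ', sum_transferA_mul_transferB (κ := κ) (phase_mul_phase_neg θ₁)
      (by rw [mul_comm]; exact phase_mul_phase_neg θ₂)]
    · rw [hk]; push_cast; ring
    · rw [hg]; push_cast; ring
    · norm_cast
      rw [mul_pow, Real.sq_sqrt hγ.le, Real.sq_sqrt hκ]
    · exact_mod_cast hβ
  have hV : ∀ (u : ℂ) (φ₁ φ₂ : ℝ), Complex.normSq u = 1 →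
      ((realRow ![-1, 1] ![u, u] * (dualNOPA ε γ κ α β θ₁ θ₂ φ₁ φ₂).H).transpose *
        (realRow ![-1, 1] ![u, u] * (dualNOPA ε γ κ α β θ₁ θ₂ φ₁ φ₂).H)).trace =
      (Complex.normSq Δ)⁻¹ * ∑ j, (Complex.normSq (Q j) + Complex.normSq (P j)) -
        2 * (Complex.normSq Δ)⁻¹ * k *
          (cos (φ₁ + φ₂ + θ₁) + cos (φ₁ + φ₂ + θ₂)) := by
    intro u φ₁ φ₂ hu
    have hN : Complex.normSq (u / Δ) = (Complex.normSq Δ)⁻¹ := by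
      rw [map_div₀, hu, one_div]
    -- The output phases enter only `C` and `D`, so stability at zero phases suffices.
    have hA : (dualNOPA ε γ κ α β θ₁ θ₂ φ₁ φ₂).A = (dualNOPA ε γ κ α β θ₁ θ₂ 0 0).A := rfl
    rw [realRow_mul_H_eq u hγ.le (hA ▸ hs.isUnit_det) hΔ,
      trace_realRow _ (by intro j; fin_cases j <;> norm_num)]
    simp only [← hQ, ← hP, ← hΔd, normSq_phase_combination, hN]
    rw [Finset.sum_add_distrib, ← Finset.mul_sum, ← Finset.mul_sum, ← Complex.re_sum,
      ← Finset.mul_sum, hsum, mul_left_comm, Complex.re_ofReal_mul, mul_add, ← phase_add,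
      ← phase_add, Complex.add_re, phase_re, phase_re]
    ring
  refine ⟨(Complex.normSq Δ)⁻¹ * ∑ j, (Complex.normSq (Q j) + Complex.normSq (P j)),
    2 * (Complex.normSq Δ)⁻¹ * k,
    mul_nonneg (mul_nonneg zero_le_two (inv_nonneg.2 (Complex.normSq_nonneg _))) hk0,
    fun φ₁ φ₂ => ⟨?_, ?_⟩⟩
  · rw [LinearSystem.Vplus, rowPlus_eq]
    exact hV 1 φ₁ φ₂ (by simp)
  · rw [LinearSystem.Vminus, rowMinus_eq]
    exact hV Complex.I φ₁ φ₂ (by simp)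

theorem lossySystem_spectra {x y α θ₁ θ₂ : ℝ} (hx : x ∈ Ioc (0 : ℝ) 1) (hy : y ∈ Ioc (0 : ℝ) 1)
    (hα : α ∈ Ioc (0 : ℝ) 1) (hs : (lossySystem x y α θ₁ θ₂ 0 0).IsStable) :
    ∃ c K : ℝ, 0 ≤ K ∧ ∀ φ₁ φ₂ : ℝ,
      (lossySystem x y α θ₁ θ₂ φ₁ φ₂).Vplus =
        c - K * (cos ((θ₁ - θ₂) / 2) * cos (φ₁ + φ₂ + (θ₁ + θ₂) / 2)) ∧
      (lossySystem x y α θ₁ θ₂ φ₁ φ₂).Vminus =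
        c - K * (cos ((θ₁ - θ₂) / 2) * cos (φ₁ + φ₂ + (θ₁ + θ₂) / 2)) := by
  obtain ⟨hx0, hx1⟩ := hx
  obtain ⟨hy0, hy1⟩ := hy
  have hr : 0 < γr := by norm_num [γr]
  -- The crude bound `√2 ≥ 1` already gives `4κ ≤ 2 × 10⁷ < γr ≤ γ`.
  have hκγ : 4 * (3 * 10 ^ 6 / (√2 * 0.6) * x) ≤ γr / y := by
    have h2 : (1 : ℝ) ≤ √2 := Real.one_le_sqrt.2 one_le_two
    have h3 : (3 * 10 ^ 6 / (√2 * 0.6) : ℝ) ≤ 3 * 10 ^ 6 / (1 * 0.6) := by gcongr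
    have h4 : (3 * 10 ^ 6 / (√2 * 0.6) * x : ℝ) ≤ 3 * 10 ^ 6 / (1 * 0.6) * 1 := by gcongr
    have h5 : γr ≤ γr / y := le_div_self hr.le hy0 hy1
    norm_num [γr] at h4 h5 ⊢
    linarith
  obtain ⟨c, K, hK, hV⟩ := dualNOPA_spectra (mul_pos hx0 hr) (div_pos hr hy0) (by positivity)
    hκγ hα (Real.sq_sqrt (by nlinarith [hα.1, hα.2])) hs
  have hcos : ∀ φ : ℝ, cos (φ + θ₁) + cos (φ + θ₂) =
      2 * (cos ((θ₁ - θ₂) / 2) * cos (φ + (θ₁ + θ₂) / 2)) := fun φ => by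
    rw [cos_add_cos, show (φ + θ₁ + (φ + θ₂)) / 2 = φ + (θ₁ + θ₂) / 2 by ring,
      show (φ + θ₁ - (φ + θ₂)) / 2 = (θ₁ - θ₂) / 2 by ring]
    ring
  refine ⟨c, K * 2, by positivity, fun φ₁ φ₂ => ?_⟩
  have := hV φ₁ φ₂
  rwa [hcos, ← mul_assoc K] at this

theorem minimizesSpectra_of_cos {x y α θ₁ θ₂ φ₀ : ℝ} (hx : x ∈ Ioc (0 : ℝ) 1)
    (hy : y ∈ Ioc (0 : ℝ) 1) (hα : α ∈ Ioc (0 : ℝ) 1)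
    (hs : (lossySystem x y α θ₁ θ₂ 0 0).IsStable) (hφ₀ : φ₀ ∈ Ioc (-(2 * π)) (2 * π))
    (h : cos ((θ₁ - θ₂) / 2) * cos (φ₀ + (θ₁ + θ₂) / 2) = |cos ((θ₁ - θ₂) / 2)|) :
    MinimizesSpectra x y α θ₁ θ₂ φ₀ := by
  obtain ⟨c, K, hK, hV⟩ := lossySystem_spectra hx hy hα hs
  refine ⟨hφ₀, fun φ₁ _ φ₂ _ hφ ψ₁ _ ψ₂ _ => ?_⟩
  have hle : cos ((θ₁ - θ₂) / 2) * cos (ψ₁ + ψ₂ + (θ₁ + θ₂) / 2) ≤ |cos ((θ₁ - θ₂) / 2)| := by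
    refine (le_abs_self _).trans ?_
    rw [abs_mul]
    exact mul_le_of_le_one_right (abs_nonneg _) (abs_cos_le_one _)
  have := mul_le_mul_of_nonneg_left hle hK
  rw [(hV φ₁ φ₂).1, (hV φ₁ φ₂).2, (hV ψ₁ ψ₂).1, (hV ψ₁ ψ₂).2, hφ, h]
  constructor <;> linarith

end DualNOPA

theorem mainTheorem6 (x y α θ₁ θ₂ m n : ℝ)
    (hx : x ∈ Ioc (0 : ℝ) 1) (hy : y ∈ Ioc (0 : ℝ) 1) (hα : α ∈ Ioc (0 : ℝ) 1)
    (hθ₁ : θ₁ ∈ Ioc (-π) π) (hθ₂ : θ₂ ∈ Ioc (-π) π)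
    (hm : m = (θ₁ - θ₂) / 2) (hn : n = (θ₁ + θ₂) / 2)
    (hstable : (DualNOPA.lossySystem x y α θ₁ θ₂ 0 0).IsStable) :
    (∀ φ₁ ∈ Ioc (-π) π, ∀ φ₂ ∈ Ioc (-π) π, ∀ ψ₁ ∈ Ioc (-π) π, ∀ ψ₂ ∈ Ioc (-π) π,
      φ₁ + φ₂ = ψ₁ + ψ₂ →
        (DualNOPA.lossySystem x y α θ₁ θ₂ φ₁ φ₂).Vplus =
          (DualNOPA.lossySystem x y α θ₁ θ₂ ψ₁ ψ₂).Vplus ∧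
        (DualNOPA.lossySystem x y α θ₁ θ₂ φ₁ φ₂).Vminus =
          (DualNOPA.lossySystem x y α θ₁ θ₂ ψ₁ ψ₂).Vminus) ∧
    (m ∈ Ioo (-(π / 2)) (π / 2) → DualNOPA.MinimizesSpectra x y α θ₁ θ₂ (-n)) ∧
    (m ∈ Ioo (-π) (-(π / 2)) ∪ Ioc (π / 2) π →
      DualNOPA.MinimizesSpectra x y α θ₁ θ₂ (π - n) ∧
      DualNOPA.MinimizesSpectra x y α θ₁ θ₂ (-π - n)) ∧
    (m = π / 2 ∨ m = -(π / 2) →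
      ∀ φ₁ ∈ Ioc (-π) π, ∀ φ₂ ∈ Ioc (-π) π, ∀ ψ₁ ∈ Ioc (-π) π, ∀ ψ₂ ∈ Ioc (-π) π,
        (DualNOPA.lossySystem x y α θ₁ θ₂ φ₁ φ₂).Vplus =
          (DualNOPA.lossySystem x y α θ₁ θ₂ ψ₁ ψ₂).Vplus ∧
        (DualNOPA.lossySystem x y α θ₁ θ₂ φ₁ φ₂).Vminus =
          (DualNOPA.lossySystem x y α θ₁ θ₂ ψ₁ ψ₂).Vminus) := by
  obtain ⟨c, K, -, hV⟩ := DualNOPA.lossySystem_spectra hx hy hα hstable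
  obtain ⟨h1, h1'⟩ := hθ₁
  obtain ⟨h2, h2'⟩ := hθ₂
  have hπ := pi_pos
  refine ⟨fun φ₁ _ φ₂ _ ψ₁ _ ψ₂ _ h => ?_, fun h => ?_, fun h => ?_,
    fun h φ₁ _ φ₂ _ ψ₁ _ ψ₂ _ => ?_⟩
  · rw [(hV φ₁ φ₂).1, (hV φ₁ φ₂).2, (hV ψ₁ ψ₂).1, (hV ψ₁ ψ₂).2, h]
    exact ⟨rfl, rfl⟩
  · refine DualNOPA.minimizesSpectra_of_cos hx hy hα hstable ⟨by linarith, by linarith⟩ ?_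
    rw [← hm, ← hn, neg_add_cancel, cos_zero, mul_one, abs_of_pos (cos_pos_of_mem_Ioo h)]
  · have hcos : cos m ≤ 0 := by
      rcases h with h | h
      · rw [← cos_neg]
        exact cos_nonpos_of_pi_div_two_le_of_le (by linarith [h.2]) (by linarith [h.1])
      · exact cos_nonpos_of_pi_div_two_le_of_le h.1.le (by linarith [h.2])
    -- Strictness matters: `-π - n` must avoid the excluded endpoint `-2π`.
    have hnπ : n < π := by
      rcases h with h | h
      · linarith [h.2]
      · linarith [h.1]
    constructor
    · refine DualNOPA.minimizesSpectra_of_cos hx hy hα hstable ⟨by linarith, by linarith⟩ ?_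
      rw [← hm, ← hn, sub_add_cancel, cos_pi, mul_neg_one, abs_of_nonpos hcos]
    · refine DualNOPA.minimizesSpectra_of_cos hx hy hα hstable ⟨by linarith, by linarith⟩ ?_
      rw [← hm, ← hn, sub_add_cancel, cos_neg, cos_pi, mul_neg_one, abs_of_nonpos hcos]
  · have hcos : cos m = 0 := by
      rcases h with h | h <;> simp [h]
    rw [(hV φ₁ φ₂).1, (hV φ₁ φ₂).2, (hV ψ₁ ψ₂).1, (hV ψ₁ ψ₂).2, ← hm, hcos]
    simp
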